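/- For a permutation $\sigma=\sigma_1\cdots\sigma_n$ of $\{1,\dots,n\}$, let $\mathrm{mmp}^{(0,2,0,2)}(\sigma)$ be the number of indices $i$ such that at least two entries to the left of $\sigma_i$ are greater than $\sigma_i$ and at least two entries to the right of $\sigma_i$ are smaller than $\sigma_i$. Let $S_n(123)$ be the set of permutations of $\{1,\dots,n\}$ that have no increasing subsequence of length $3$, put $$Q_{n,123}^{(0,2,0,2)}(x)=\sum_{\sigma\in S_n(123)}x^{\mathrm{mmp}^{(0,2,0,2)}(\sigma)},$$ and let $C_m=\frac{1}{m+1}\binom{2m}{m}$ be the $m$-th Catalan number. Write $[x^k]$ for the coefficient of $x^k$, which is $0$ when $k<0$. Then for every $n\ge 7$: $$\begin{aligned} [x^{n-8}]\,Q_{n,123}^{(0,2,0,2)}(x)&=C_n-6C_{n-1}+11C_{n-2}-6C_{n-3}+C_{n-4}-2n^2+16n-34,\\ [x^{n-7}]\,Q_{n,123}^{(0,2,0,2)}(x)&=6C_{n-1}-24C_{n-2}+24C_{n-3}-6C_{n-4}+2n^2-28n+80,\\ [x^{n-6}]\,Q_{n,123}^{(0,2,0,2)}(x)&=13C_{n-2}-30C_{n-3}+13C_{n-4}+12n-64,\\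 [x^{n-5}]\,Q_{n,123}^{(0,2,0,2)}(x)&=12C_{n-3}-12C_{n-4}+18,\\ [x^{n-4}]\,Q_{n,123}^{(0,2,0,2)}(x)&=4C_{n-4}. \end{aligned}$$ -/

import Mathlib

open Polynomial

/-- The pattern `τ` occurs in `σ`: there are positions `i 0 < i 1 < ⋯ < i (j-1)` such that the
entries of `σ` at these positions are in the same relative order as the entries of `τ`. -/
def PatternOccurs {j n : ℕ} (τ : Equiv.Perm (Fin j)) (σ : Equiv.Perm (Fin n)) : Prop :=
  ∃ i : Fin j → Fin n, StrictMono i ∧ ∀ p q : Fin j, σ (i p) < σ (i q) ↔ τ p < τ q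

/-- The pattern `123`, as a permutation of three letters (the identity). -/
def pattern123 : Equiv.Perm (Fin 3) := Equiv.refl (Fin 3)

/-- `σ` matches the quadrant marked mesh pattern `MMP(a,b,c,d)` at position `i`: relative to the
point `(i, σ i)` of the graph of `σ` there are at least `a`, `b`, `c`, `d` points of the graph in
quadrants I (right, above), II (left, above), III (left, below), IV (right, below). -/
def MatchesMMP {n : ℕ} (a b c d : ℕ) (σ : Equiv.Perm (Fin n)) (i : Fin n) : Prop :=
  a ≤ (Finset.univ.filter fun k : Fin n => i < k ∧ σ i < σ k).card ∧
  b ≤ (Finset.univ.filter fun k : Fin n => k < i ∧ σ i < σ k).card ∧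
  c ≤ (Finset.univ.filter fun k : Fin n => k < i ∧ σ k < σ i).card ∧
  d ≤ (Finset.univ.filter fun k : Fin n => i < k ∧ σ k < σ i).card

open Classical in
/-- The number of positions at which `σ` matches `MMP(a,b,c,d)`. -/
noncomputable def mmp {n : ℕ} (a b c d : ℕ) (σ : Equiv.Perm (Fin n)) : ℕ :=
  (Finset.univ.filter fun i : Fin n => MatchesMMP a b c d σ i).card

open Classical in
/-- The finite set of permutations of `n` letters that avoid the pattern `τ`. -/
noncomputable def avoiders {j : ℕ} (τ : Equiv.Perm (Fin j)) (n : ℕ) :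
    Finset (Equiv.Perm (Fin n)) :=
  Finset.univ.filter fun σ => ¬ PatternOccurs τ σ

/-- The polynomial `Q_{n,τ}^{(a,b,c,d)}(x)`, the sum of `x ^ mmp^{(a,b,c,d)}(σ)` over the
permutations `σ` of `n` letters that avoid `τ`. -/
noncomputable def Qpoly {j : ℕ} (τ : Equiv.Perm (Fin j)) (a b c d n : ℕ) : ℤ[X] :=
  ∑ σ ∈ avoiders τ n, X ^ mmp a b c d σ

/-- The coefficient of `x ^ k` in a polynomial, for an integer exponent `k`
(zero if `k` is negative). -/
def coeffAt (p : ℤ[X]) (k : ℤ) : ℤ :=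
  if 0 ≤ k then p.coeff k.toNat else 0

/-!
Write the graph of a permutation `σ` of `n` letters as the points `(i, σ i)`. If `σ` avoids 123,
then a point has either no point to its lower left or no point to its upper right; hence it has
fewer than two points to its upper left only if it lies in the first two columns or in the two
highest rows, and symmetrically for the lower right. So the points that do not match
`MMP(0,2,0,2)` are those of a frame of width two, and `mmp σ + 8 = n + k`, where `k` is the number
of points in the four 2-by-2 corners of the square (`Avoids123.mmp_add_eight`). It remains to find
the distribution of `k` over the avoiders.

* There are `catalan n` avoiders (`card_avoiders_pattern123`). Removing the first letter shows that
  the number of avoiders whose entries from `c` upwards decrease satisfies the recurrence of the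
  ballot numbers `(n + c).choose n - (n + c).choose (n + 1)`.
* A point in one of the top left cells `(0, n - 1)`, `(1, n - 1)`, `(0, n - 2)` takes part in no
  occurrence of 123, and can be deleted; the fourth cell is occupied only together with the first.
  Inclusion and exclusion over these cells gives the distribution of the number of points in the
  top left corner as `1 - 3s + s²`, `3s - 3s²`, `2s²`, where `s` lowers the length by one. The
  bottom right corner is unaffected by the deletion, so the joint distribution comes from applying
  this twice (`sum_avoiders_add_corners`).
* An avoider with a point in the bottom left corner is nearly decreasing: it is determined by its
  first entry and by the position of its smallest entry, and these avoiders can be listed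
  (`sum_bottomLeftEffect`). They produce the polynomial terms. The top right corner is treated by
  a half turn of the graph, and the two corners are not occupied at the same time when `7 ≤ n`.
-/

/-! ### Avoiding 123 and inserting a point -/

/-- `σ` has no increasing subsequence of length three. -/
def Avoids123 {n : ℕ} (σ : Equiv.Perm (Fin n)) : Prop :=
  ∀ a b c : Fin n, a < b → b < c → σ a < σ b → ¬ σ b < σ c

theorem mem_avoiders_pattern123 {n : ℕ} {σ : Equiv.Perm (Fin n)} :
    σ ∈ avoiders pattern123 n ↔ Avoids123 σ := by
  simp only [avoiders, Finset.mem_filter, Finset.mem_univ, true_and, Avoids123]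
  constructor
  · intro h a b c hab hbc h1 h2
    refine h ⟨![a, b, c], ?_, ?_⟩
    · intro p q hpq
      fin_cases p <;> fin_cases q <;> simp_all
      exact hab.trans hbc
    · intro p q
      have h3 := h1.trans h2
      fin_cases p <;> fin_cases q <;> simp [pattern123, h1, h2, h3, h1.le, h2.le, h3.le]
  · rintro h ⟨i, hi, hp⟩
    exact h (i 0) (i 1) (i 2) (hi (by decide)) (hi (by decide))
      ((hp 0 1).2 (by simp [pattern123])) ((hp 1 2).2 (by simp [pattern123]))

/-- The permutation obtained from `τ` by adding the point `(i, v)` to its graph: the old positions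
are shifted past `i` and the old values past `v`. -/
def insertPoint {n : ℕ} (i v : Fin (n + 1)) (τ : Equiv.Perm (Fin n)) :
    Equiv.Perm (Fin (n + 1)) :=
  (finSuccEquiv' i).trans (τ.optionCongr.trans (finSuccEquiv' v).symm)

@[simp]
theorem insertPoint_self {n : ℕ} (i v : Fin (n + 1)) (τ : Equiv.Perm (Fin n)) :
    insertPoint i v τ i = v := by
  simp [insertPoint]

@[simp]
theorem insertPoint_succAbove {n : ℕ} (i v : Fin (n + 1)) (τ : Equiv.Perm (Fin n)) (k : Fin n) :
    insertPoint i v τ (i.succAbove k) = v.succAbove (τ k) := by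
  simp [insertPoint]

@[simp]
theorem insertPoint_zero_succ {n : ℕ} (v : Fin (n + 1)) (τ : Equiv.Perm (Fin n)) (k : Fin n) :
    insertPoint 0 v τ k.succ = v.succAbove (τ k) := by
  rw [← Fin.succAbove_zero_apply, insertPoint_succAbove]

theorem insertPoint_injective {n : ℕ} (i v : Fin (n + 1)) :
    Function.Injective (insertPoint i v) := by
  intro τ₁ τ₂ h
  refine Equiv.ext fun k => ?_
  have := congrArg (fun σ : Equiv.Perm (Fin (n + 1)) => σ (i.succAbove k)) h
  simpa using this

theorem exists_eq_insertPoint {n : ℕ} {i v : Fin (n + 1)} {σ : Equiv.Perm (Fin (n + 1))}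
    (h : σ i = v) : ∃ τ, σ = insertPoint i v τ := by
  let ρ : Equiv.Perm (Option (Fin n)) := ((finSuccEquiv' i).symm.trans σ).trans (finSuccEquiv' v)
  have hρ : ρ none = none := by simp [ρ, h]
  refine ⟨Equiv.removeNone ρ, ?_⟩
  have := map_equiv_removeNone ρ
  rw [hρ, Equiv.swap_self] at this
  ext k
  simp only [insertPoint]
  erw [this]
  simp [ρ]

theorem Avoids123.of_insertPoint {n : ℕ} {i v : Fin (n + 1)} {τ : Equiv.Perm (Fin n)}
    (h : Avoids123 (insertPoint i v τ)) : Avoids123 τ := by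
  intro a b c hab hbc h1 h2
  refine h (i.succAbove a) (i.succAbove b) (i.succAbove c) ?_ ?_ ?_ ?_ <;>
    simpa

/-- An insertion preserves avoidance when the new point takes part in no occurrence of 123. -/
theorem Avoids123.insertPoint {n : ℕ} {i v : Fin (n + 1)} {τ : Equiv.Perm (Fin n)}
    (h : Avoids123 τ)
    (hi : ∀ a b c, a < b → b < c → insertPoint i v τ a < insertPoint i v τ b →
      insertPoint i v τ b < insertPoint i v τ c → a ≠ i ∧ b ≠ i ∧ c ≠ i) :
    Avoids123 (insertPoint i v τ) := by
  intro a b c hab hbc h1 h2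
  obtain ⟨ha, hb, hc⟩ := hi a b c hab hbc h1 h2
  obtain ⟨a, rfl⟩ := Fin.exists_succAbove_eq ha
  obtain ⟨b, rfl⟩ := Fin.exists_succAbove_eq hb
  obtain ⟨c, rfl⟩ := Fin.exists_succAbove_eq hc
  simp only [insertPoint_succAbove, Fin.succAbove_lt_succAbove_iff] at hab hbc h1 h2
  exact h a b c hab hbc h1 h2

/-- The entries of `τ` that are at least `c` appear in decreasing order. -/
def DecreasingFrom {n : ℕ} (c : ℕ) (τ : Equiv.Perm (Fin n)) : Prop :=
  ∀ i j : Fin n, i < j → c ≤ (τ i : ℕ) → c ≤ (τ j : ℕ) → τ j < τ i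

theorem DecreasingFrom.mono {n c d : ℕ} {τ : Equiv.Perm (Fin n)} (h : DecreasingFrom c τ)
    (hcd : c ≤ d) : DecreasingFrom d τ :=
  fun i j hij hi hj => h i j hij (hcd.trans hi) (hcd.trans hj)

theorem val_lt_succAbove_iff {n : ℕ} (v : Fin (n + 1)) (k : Fin n) :
    v < v.succAbove k ↔ (v : ℕ) ≤ k := by
  rw [Fin.lt_succAbove_iff_le_castSucc, Fin.le_def, Fin.val_castSucc]

/-- A new first letter `v` is the start of an occurrence of 123 precisely when the old entries
that end up above it contain an ascent. -/
theorem avoids123_insertPoint_zero_iff {n : ℕ} {v : Fin (n + 1)} {τ : Equiv.Perm (Fin n)} :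
    Avoids123 (insertPoint 0 v τ) ↔ Avoids123 τ ∧ DecreasingFrom v τ := by
  constructor
  · refine fun h => ⟨h.of_insertPoint, fun i j hij hi hj => ?_⟩
    have := h 0 i.succ j.succ (Fin.succ_pos i) (by simpa using hij)
      (by simpa [val_lt_succAbove_iff] using hi)
    simp only [insertPoint_zero_succ, Fin.succAbove_lt_succAbove_iff, not_lt] at this
    exact lt_of_le_of_ne this (fun e => hij.ne (τ.injective e).symm)
  · rintro ⟨h, hd⟩
    refine h.insertPoint fun a b c hab hbc h1 h2 => ?_
    have hb0 : b ≠ 0 := (lt_of_le_of_lt (Fin.zero_le a) hab).ne'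
    have hc0 : c ≠ 0 := (lt_of_le_of_lt (Fin.zero_le b) hbc).ne'
    refine ⟨?_, hb0, hc0⟩
    rintro rfl
    obtain ⟨b, rfl⟩ := Fin.exists_succ_eq.2 hb0
    obtain ⟨c, rfl⟩ := Fin.exists_succ_eq.2 hc0
    simp only [insertPoint_self, insertPoint_zero_succ, Fin.succAbove_lt_succAbove_iff,
      val_lt_succAbove_iff, Fin.succ_lt_succ_iff] at h1 h2 hbc
    exact (hd b c hbc h1 (h1.trans (Fin.le_def.1 h2.le))).not_gt h2

/-- Summing over all permutations by the first letter and the remaining pattern. -/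
theorem sum_perm_eq_sum_insertPoint_zero {n : ℕ} (f : Equiv.Perm (Fin (n + 1)) → ℕ) :
    ∑ σ, f σ = ∑ v, ∑ τ, f (insertPoint 0 v τ) := by
  rw [← Fintype.sum_prod_type']
  symm
  refine Fintype.sum_bijective (fun p : Fin (n + 1) × Equiv.Perm (Fin n) => insertPoint 0 p.1 p.2)
    ⟨?_, ?_⟩ _ _ (fun _ => rfl)
  · rintro ⟨v, τ⟩ ⟨w, ρ⟩ h
    have hv : v = w := by
      have := congrArg (fun σ : Equiv.Perm (Fin (n + 1)) => σ 0) h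
      simpa using this
    subst hv
    exact congrArg (Prod.mk v) (insertPoint_injective _ _ h)
  · intro σ
    obtain ⟨τ, hτ⟩ := exists_eq_insertPoint (rfl : σ 0 = σ 0)
    exact ⟨(σ 0, τ), hτ.symm⟩

/-! ### Counting the avoiders -/

open Classical in
/-- The number of 123-avoiders of length `n` whose entries from `c` upwards are decreasing. -/
noncomputable def avoidCount (n c : ℕ) : ℕ :=
  ∑ τ : Equiv.Perm (Fin n), if Avoids123 τ ∧ DecreasingFrom c τ then 1 else 0

theorem decreasingFrom_insertPoint_zero_last {n c : ℕ} {τ : Equiv.Perm (Fin n)} :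
    DecreasingFrom c (insertPoint 0 (Fin.last n) τ) ↔ DecreasingFrom c τ := by
  constructor
  · intro h i j hij hi hj
    simpa using h i.succ j.succ (by simpa using hij) (by simpa using hi) (by simpa using hj)
  · intro h i j hij hi hj
    obtain ⟨j, rfl⟩ := Fin.exists_succ_eq.2 (lt_of_le_of_lt (Fin.zero_le i) hij).ne'
    rcases Fin.eq_zero_or_eq_succ i with rfl | ⟨i, rfl⟩
    · simp [Fin.castSucc_lt_last]
    · simpa using h i j (by simpa using hij) (by simpa using hi) (by simpa using hj)

theorem DecreasingFrom.insertPoint_zero {n c : ℕ} {v : Fin (n + 1)} {τ : Equiv.Perm (Fin n)}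
    (hv : (v : ℕ) < c) (h : DecreasingFrom v τ) : DecreasingFrom c (insertPoint 0 v τ) := by
  intro i j hij hi hj
  obtain ⟨j, rfl⟩ := Fin.exists_succ_eq.2 (lt_of_le_of_lt (Fin.zero_le i) hij).ne'
  rcases Fin.eq_zero_or_eq_succ i with rfl | ⟨i, rfl⟩
  · simp at hi; omega
  · simp only [insertPoint_zero_succ, Fin.succAbove_lt_succAbove_iff] at hi hj ⊢
    exact h i j (by simpa using hij) ((val_lt_succAbove_iff v _).1 (Fin.lt_def.2 (hv.trans_le hi)))
      ((val_lt_succAbove_iff v _).1 (Fin.lt_def.2 (hv.trans_le hj)))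

/-- A first letter that lies in the range from `c` upwards and is not the maximum is followed by
the maximum. -/
theorem not_decreasingFrom_insertPoint_zero {n c : ℕ} {v : Fin (n + 1)} {τ : Equiv.Perm (Fin n)}
    (hv : c ≤ (v : ℕ)) (hvn : (v : ℕ) < n) : ¬ DecreasingFrom c (insertPoint 0 v τ) := by
  intro h
  have hn : 0 < n := by omega
  let k : Fin n := τ.symm ⟨n - 1, by omega⟩
  have hk : v < insertPoint 0 v τ k.succ := by
    rw [insertPoint_zero_succ, val_lt_succAbove_iff]
    simp only [k, Equiv.apply_symm_apply]
    omega
  have := h 0 k.succ (Fin.succ_pos k) (by simpa using hv) (hv.trans (Fin.le_def.1 hk.le))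
  rw [insertPoint_self] at this
  exact this.not_gt hk

theorem avoidCount_succ (n c : ℕ) (hc : c ≤ n) :
    avoidCount (n + 1) c = ∑ v ∈ Finset.range (c + 1), avoidCount n v := by
  classical
  have key : ∀ v : Fin (n + 1), (∑ τ, if Avoids123 (insertPoint 0 v τ) ∧
      DecreasingFrom c (insertPoint 0 v τ) then 1 else 0) =
      (if (v : ℕ) < c then avoidCount n v else 0) + if (v : ℕ) = n then avoidCount n c else 0 := by
    intro v
    simp only [avoids123_insertPoint_zero_iff]
    rcases lt_or_ge (v : ℕ) c with h | h
    · have hv : (v : ℕ) ≠ n := by omega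
      rw [if_pos h, if_neg hv, add_zero, avoidCount]
      refine Finset.sum_congr rfl fun τ _ => if_congr ?_ rfl rfl
      exact ⟨fun h => h.1, fun h' => ⟨h', h'.2.insertPoint_zero h⟩⟩
    · rw [if_neg (not_lt.2 h), zero_add]
      split_ifs with hv
      · obtain rfl : v = Fin.last n := Fin.ext hv
        simp only [decreasingFrom_insertPoint_zero_last, avoidCount]
        refine Finset.sum_congr rfl fun τ _ => if_congr ?_ rfl rfl
        exact ⟨fun h => ⟨h.1.1, h.2⟩, fun h' => ⟨⟨h'.1, h'.2.mono h⟩, h'.2⟩⟩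
      · have hvn : (v : ℕ) < n := by omega
        simp [not_decreasingFrom_insertPoint_zero h hvn]
  rw [avoidCount, sum_perm_eq_sum_insertPoint_zero, Finset.sum_congr rfl fun v _ => key v,
    Finset.sum_add_distrib, Finset.sum_range_succ,
    Fin.sum_univ_eq_sum_range (fun v => if v < c then avoidCount n v else 0),
    Fin.sum_univ_eq_sum_range (fun v => if v = n then avoidCount n c else 0)]
  congr 1
  · rw [← Finset.sum_filter]
    refine Finset.sum_congr ?_ fun _ _ => rfl
    ext v; simp; omega
  · simp

theorem avoidCount_eq_of_le {n c : ℕ} (hc : n ≤ c + 1) : avoidCount n c = avoidCount n n := by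
  classical
  have : ∀ d, n ≤ d + 1 → ∀ τ : Equiv.Perm (Fin n), DecreasingFrom d τ := by
    intro d hd τ i j hij hi hj
    exact absurd (τ.injective (Fin.ext (show (τ i : ℕ) = τ j by omega))) hij.ne
  simp only [avoidCount, this c hc, this n (by omega)]

/-- The avoiders counted by `avoidCount` are enumerated by ballot numbers. -/
theorem avoidCount_eq (n c : ℕ) (hc : c ≤ n) :
    (avoidCount n c : ℤ) = (n + c).choose n - (n + c).choose (n + 1) := by
  induction n generalizing c with
  | zero =>
    obtain rfl : c = 0 := by omega
    simp [avoidCount, Avoids123, DecreasingFrom]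
  | succ n ih =>
    have main : ∀ c ≤ n, (avoidCount (n + 1) c : ℤ) =
        (n + 1 + c).choose (n + 1) - (n + 1 + c).choose (n + 1 + 1) := by
      intro c hc
      rw [avoidCount_succ n c hc]
      push_cast
      rw [Finset.sum_congr rfl fun v hv => ih v (by simp at hv; omega)]
      clear ih hc
      induction c with
      | zero => simp
      | succ c ih =>
        rw [Finset.sum_range_succ, ih]
        have e1 : (n + 1 + (c + 1)).choose (n + 1) =
          (n + (c + 1)).choose n + (n + (c + 1)).choose (n + 1) := by
          rw [show n + 1 + (c + 1) = (n + (c + 1)) + 1 by ring, Nat.choose_succ_succ]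
        have e2 : (n + 1 + (c + 1)).choose (n + 1 + 1) =
          (n + (c + 1)).choose (n + 1) + (n + (c + 1)).choose (n + 1 + 1) := by
          rw [show n + 1 + (c + 1) = (n + (c + 1)) + 1 by ring, Nat.choose_succ_succ]
        rw [e1, e2, show n + 1 + c = n + (c + 1) by ring]
        push_cast
        ring
    rcases hc.lt_or_eq with h | rfl
    · exact main c (by omega)
    · rw [← avoidCount_eq_of_le (le_refl (n + 1)), main n le_rfl]
      rw [show n + 1 + (n + 1) = (2 * n + 1) + 1 by ring, show n + 1 + n = 2 * n + 1 by ring,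
        Nat.choose_succ_succ (2 * n + 1) n, Nat.choose_succ_succ (2 * n + 1) (n + 1)]
      have : (2 * n + 1).choose n = (2 * n + 1).choose (n + 1) :=
        Nat.choose_symm_of_eq_add (by ring)
      rw [this]
      push_cast [Nat.succ_eq_add_one]
      ring

theorem card_avoiders_pattern123 (n : ℕ) : (avoiders pattern123 n).card = catalan n := by
  classical
  have h1 : (avoiders pattern123 n).card = avoidCount n n := by
    rw [avoidCount, ← Finset.card_filter]
    congr 1
    ext τ
    have : DecreasingFrom n τ := fun i j _ hi => absurd (τ i).2 (not_lt.2 hi)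
    simp [mem_avoiders_pattern123, this]
  have h2 := avoidCount_eq n n le_rfl
  rw [← h1, ← two_mul] at h2
  have h3 := succ_mul_catalan_eq_centralBinom n
  rw [Nat.centralBinom] at h3
  have h4 := Nat.choose_succ_right_eq (2 * n) n
  rw [show 2 * n - n = n by omega] at h4
  zify at h3 h4 ⊢
  have : ((n : ℤ) + 1) ≠ 0 := by positivity
  apply mul_left_cancel₀ this
  rw [h2, h3]
  linear_combination -h4

/-! ### Matches of the mesh pattern and the corners of the graph -/

/-- `i` is one of the two smallest elements. -/
def IsLow {n : ℕ} (i : Fin n) : Prop := (i : ℕ) < 2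

/-- `i` is one of the two largest elements. -/
def IsHigh {n : ℕ} (i : Fin n) : Prop := n ≤ (i : ℕ) + 2

open Classical in
/-- The number of points `(i, σ i)` of the graph of `σ` with `P i` and `R (σ i)`. -/
noncomputable def pointCount {n : ℕ} (P R : Fin n → Prop) (σ : Equiv.Perm (Fin n)) : ℕ :=
  (Finset.univ.filter fun i => P i ∧ R (σ i)).card

/-- The number of points in the 2-by-2 top left corner of the graph. -/
noncomputable def topLeft {n : ℕ} (σ : Equiv.Perm (Fin n)) : ℕ := pointCount IsLow IsHigh σ

/-- The number of points in the 2-by-2 bottom right corner of the graph. -/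
noncomputable def bottomRight {n : ℕ} (σ : Equiv.Perm (Fin n)) : ℕ := pointCount IsHigh IsLow σ

/-- The number of points in the 2-by-2 bottom left corner of the graph. -/
noncomputable def bottomLeft {n : ℕ} (σ : Equiv.Perm (Fin n)) : ℕ := pointCount IsLow IsLow σ

/-- The number of points in the 2-by-2 top right corner of the graph. -/
noncomputable def topRight {n : ℕ} (σ : Equiv.Perm (Fin n)) : ℕ := pointCount IsHigh IsHigh σ

theorem pointCount_symm {n : ℕ} (P R : Fin n → Prop) (σ : Equiv.Perm (Fin n)) :
    pointCount P R σ.symm = pointCount R P σ := by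
  classical
  refine Finset.card_bij' (fun i _ => σ.symm i) (fun i _ => σ i) ?_ ?_ ?_ ?_ <;>
    simp +contextual

/-- Among the larger entries of a 123-avoider, fewer than two are to the left of a given point
only if that point is in the first two positions or takes one of the two largest values. -/
theorem Avoids123.two_le_card_upper_left_iff {n : ℕ} {σ : Equiv.Perm (Fin n)} (h : Avoids123 σ)
    (i : Fin n) : 2 ≤ (Finset.univ.filter fun k : Fin n => k < i ∧ σ i < σ k).card ↔
      ¬ IsLow i ∧ ¬ IsHigh (σ i) := by
  classical
  have hc1 : (Finset.univ.filter fun k : Fin n => k < i).card = i := by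
    rw [Finset.filter_gt_eq_Iio, Fin.card_Iio]
  have hc2 : (Finset.univ.filter fun k : Fin n => σ i < σ k).card = n - 1 - σ i := by
    rw [← Fin.card_Ioi, ← Finset.filter_lt_eq_Ioi]
    refine Finset.card_bij' (fun i _ => σ i) (fun i _ => σ.symm i) ?_ ?_ ?_ ?_ <;> simp
  unfold IsLow IsHigh
  constructor
  · intro hb
    have h1 := hb.trans (Finset.card_le_card (t := Finset.univ.filter fun k : Fin n => k < i)
      (fun k hk => by simp at hk ⊢; exact hk.1))
    have h2 := hb.trans (Finset.card_le_card
      (t := Finset.univ.filter fun k : Fin n => σ i < σ k)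
      (fun k hk => by simp at hk ⊢; exact hk.2))
    omega
  · rintro ⟨h1, h2⟩
    by_cases hl : ∃ a, a < i ∧ σ a < σ i
    · obtain ⟨a, ha, ha'⟩ := hl
      have : (Finset.univ.filter fun k : Fin n => k < i ∧ σ i < σ k) =
          Finset.univ.filter fun k : Fin n => σ i < σ k := by
        ext k
        simp only [Finset.mem_filter, Finset.mem_univ, true_and, and_iff_right_iff_imp]
        intro hk
        by_contra hki
        rcases (not_lt.1 hki).lt_or_eq with h3 | rfl
        · exact h a i k ha h3 ha' hk
        · exact lt_irrefl _ hk
      rw [this, hc2]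
      omega
    · push Not at hl
      have : (Finset.univ.filter fun k : Fin n => k < i ∧ σ i < σ k) =
          Finset.univ.filter fun k : Fin n => k < i := by
        ext k
        simp only [Finset.mem_filter, Finset.mem_univ, true_and, and_iff_left_iff_imp]
        exact fun hk => lt_of_le_of_ne (hl k hk) fun e => hk.ne' (σ.injective e)
      rw [this, hc1]
      omega

/-- The graph of `σ` rotated by a half turn. -/
def reverseComplement {n : ℕ} (σ : Equiv.Perm (Fin n)) : Equiv.Perm (Fin n) :=
  Fin.revPerm.trans (σ.trans Fin.revPerm)

@[simp]
theorem reverseComplement_apply {n : ℕ} (σ : Equiv.Perm (Fin n)) (i : Fin n) :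
    reverseComplement σ i = (σ i.rev).rev := rfl

theorem reverseComplement_involutive {n : ℕ} :
    Function.Involutive (reverseComplement : Equiv.Perm (Fin n) → Equiv.Perm (Fin n)) := by
  intro σ
  ext i
  simp

theorem Avoids123.reverseComplement {n : ℕ} {σ : Equiv.Perm (Fin n)} (h : Avoids123 σ) :
    Avoids123 (reverseComplement σ) := by
  intro a b c hab hbc h1 h2
  simp only [reverseComplement_apply, Fin.rev_lt_rev] at h1 h2
  exact h c.rev b.rev a.rev (Fin.rev_lt_rev.2 hbc) (Fin.rev_lt_rev.2 hab) h2 h1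

@[simp]
theorem isLow_rev {n : ℕ} {i : Fin n} : IsLow i.rev ↔ IsHigh i := by
  simp only [IsLow, IsHigh, Fin.val_rev]; omega

@[simp]
theorem isHigh_rev {n : ℕ} {i : Fin n} : IsHigh i.rev ↔ IsLow i := by
  simp only [IsLow, IsHigh, Fin.val_rev]; omega

theorem pointCount_reverseComplement {n : ℕ} (P R : Fin n → Prop) (σ : Equiv.Perm (Fin n)) :
    pointCount P R (reverseComplement σ) = pointCount (fun i => P i.rev) (fun i => R i.rev) σ := by
  refine Finset.card_bij' (fun i _ => i.rev) (fun i _ => i.rev) ?_ ?_ ?_ ?_ <;>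
    simp only [Finset.mem_filter, Finset.mem_univ, true_and] <;> simp +contextual

@[simp]
theorem topLeft_reverseComplement {n : ℕ} (σ : Equiv.Perm (Fin n)) :
    topLeft (reverseComplement σ) = bottomRight σ := by
  simp [topLeft, bottomRight, pointCount_reverseComplement]

@[simp]
theorem bottomRight_reverseComplement {n : ℕ} (σ : Equiv.Perm (Fin n)) :
    bottomRight (reverseComplement σ) = topLeft σ := by
  simp [topLeft, bottomRight, pointCount_reverseComplement]

@[simp]
theorem bottomLeft_reverseComplement {n : ℕ} (σ : Equiv.Perm (Fin n)) :
    bottomLeft (reverseComplement σ) = topRight σ := by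
  simp [topRight, bottomLeft, pointCount_reverseComplement]

theorem sum_avoiders_reverseComplement {n : ℕ} (f : Equiv.Perm (Fin n) → ℤ) :
    ∑ σ ∈ avoiders pattern123 n, f (reverseComplement σ) = ∑ σ ∈ avoiders pattern123 n, f σ := by
  refine Finset.sum_nbij' reverseComplement reverseComplement ?_ ?_ ?_ ?_ ?_
  · exact fun σ h => mem_avoiders_pattern123.2 (mem_avoiders_pattern123.1 h).reverseComplement
  · exact fun σ h => mem_avoiders_pattern123.2 (mem_avoiders_pattern123.1 h).reverseComplement
  · exact fun σ _ => reverseComplement_involutive σ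
  · exact fun σ _ => reverseComplement_involutive σ
  · exact fun σ _ => rfl

theorem Avoids123.two_le_card_lower_right_iff {n : ℕ} {σ : Equiv.Perm (Fin n)} (h : Avoids123 σ)
    (i : Fin n) : 2 ≤ (Finset.univ.filter fun k : Fin n => i < k ∧ σ k < σ i).card ↔
      ¬ IsHigh i ∧ ¬ IsLow (σ i) := by
  have := h.reverseComplement.two_le_card_upper_left_iff i.rev
  simp only [reverseComplement_apply, Fin.rev_rev, isLow_rev, isHigh_rev, Fin.rev_lt_rev] at this
  rw [← this]
  have e : (Finset.univ.filter fun k : Fin n => i < k ∧ σ k < σ i).card =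
      (Finset.univ.filter fun k : Fin n => k < i.rev ∧ σ k.rev < σ i).card := by
    refine Finset.card_bij' (fun i _ => i.rev) (fun i _ => i.rev) ?_ ?_ ?_ ?_ <;>
      simp +contextual [Fin.lt_rev_iff]
  rw [e]

theorem Avoids123.matchesMMP_iff {n : ℕ} {σ : Equiv.Perm (Fin n)} (h : Avoids123 σ) (i : Fin n) :
    MatchesMMP 0 2 0 2 σ i ↔ ¬ (IsLow i ∨ IsHigh i) ∧ ¬ (IsLow (σ i) ∨ IsHigh (σ i)) := by
  rw [MatchesMMP, h.two_le_card_upper_left_iff, h.two_le_card_lower_right_iff]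
  simp only [zero_le, true_and]
  tauto

theorem card_isLow_or_isHigh {n : ℕ} (hn : 4 ≤ n)
    [DecidablePred fun i : Fin n => IsLow i ∨ IsHigh i] :
    (Finset.univ.filter fun i : Fin n => IsLow i ∨ IsHigh i).card = 4 := by
  have : (Finset.univ.filter fun i : Fin n => IsLow i ∨ IsHigh i) =
      {⟨0, by omega⟩, ⟨1, by omega⟩, ⟨n - 2, by omega⟩, ⟨n - 1, by omega⟩} := by
    ext i
    simp only [Finset.mem_filter, Finset.mem_univ, true_and, Finset.mem_insert,
      Finset.mem_singleton, Fin.ext_iff]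
    unfold IsLow IsHigh
    omega
  rw [this, Finset.card_insert_of_notMem, Finset.card_insert_of_notMem,
    Finset.card_insert_of_notMem, Finset.card_singleton] <;> simp <;> omega

theorem pointCount_or_left {n : ℕ} (P P' R : Fin n → Prop) (σ : Equiv.Perm (Fin n))
    (hP : ∀ i, P i → ¬ P' i) :
    pointCount (fun i => P i ∨ P' i) R σ = pointCount P R σ + pointCount P' R σ := by
  classical
  rw [pointCount, pointCount, pointCount, ← Finset.card_union_of_disjoint]
  · congr 1
    ext i
    simp
    tauto
  · rw [Finset.disjoint_filter]
    exact fun i _ h h' => hP i h.1 h'.1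

theorem pointCount_or_right {n : ℕ} (P R R' : Fin n → Prop) (σ : Equiv.Perm (Fin n))
    (hR : ∀ i, R i → ¬ R' i) :
    pointCount P (fun i => R i ∨ R' i) σ = pointCount P R σ + pointCount P R' σ := by
  simp only [← pointCount_symm _ P σ, pointCount_or_left _ _ _ _ hR]

/-- The points at which a 123-avoider fails to match are those of the frame formed by the two
outer rows and columns on each side; a point in a corner is on two sides of that frame. -/
theorem Avoids123.mmp_add_eight {n : ℕ} (hn : 4 ≤ n) {σ : Equiv.Perm (Fin n)} (h : Avoids123 σ) :
    mmp 0 2 0 2 σ + 8 =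
      n + (topLeft σ + bottomRight σ + bottomLeft σ + topRight σ) := by
  classical
  let E : Fin n → Prop := fun i => IsLow i ∨ IsHigh i
  have hd : ∀ i : Fin n, IsLow i → ¬ IsHigh i := fun i => by unfold IsLow IsHigh; omega
  have hk : topLeft σ + bottomRight σ + bottomLeft σ + topRight σ = pointCount E E σ := by
    rw [pointCount_or_left _ _ _ _ hd, pointCount_or_right _ _ _ _ hd,
      pointCount_or_right _ _ _ _ hd]
    simp only [topLeft, bottomRight, bottomLeft, topRight]
    ring
  have h1 : (Finset.univ.filter fun i => E i).card = 4 := card_isLow_or_isHigh hn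
  have h2 : (Finset.univ.filter fun i => E (σ i)).card = 4 := by
    rw [← h1]
    refine Finset.card_bij' (fun i _ => σ i) (fun i _ => σ.symm i) ?_ ?_ ?_ ?_ <;> simp
  have h3 : mmp 0 2 0 2 σ = ((Finset.univ.filter fun i => E i) ∪
      Finset.univ.filter fun i => E (σ i))ᶜ.card := by
    rw [mmp]
    congr 1
    ext i
    simp only [h.matchesMMP_iff, Finset.mem_filter, Finset.mem_univ, true_and, Finset.mem_compl,
      Finset.mem_union, E]
    tauto
  have h4 := Finset.card_union_add_card_inter (Finset.univ.filter fun i => E i)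
    (Finset.univ.filter fun i => E (σ i))
  rw [← Finset.filter_and] at h4
  have h5 := Finset.card_compl_add_card ((Finset.univ.filter fun i => E i) ∪
      Finset.univ.filter fun i => E (σ i))
  rw [Fintype.card_fin] at h5
  rw [hk, h3, pointCount]
  simp only [E] at *
  omega

/-! ### Deleting points of the top left corner -/

/-- A point in one of the cells `(0, n)`, `(1, n)` and `(0, n - 1)`, which are those that satisfy
`hiv`, takes part in no occurrence of 123. -/
theorem Avoids123.insertPoint_corner {n : ℕ} {i v : Fin (n + 1)} (hiv : (i : ℕ) + n ≤ v + 1)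
    {τ : Equiv.Perm (Fin n)} (h : Avoids123 τ) : Avoids123 (_root_.insertPoint i v τ) := by
  refine h.insertPoint fun a b c hab hbc h1 h2 => ⟨?_, ?_, ?_⟩ <;> rintro rfl <;>
    simp only [insertPoint_self, Fin.lt_def] at * <;> omega

theorem sum_avoiders_ite_eq {n : ℕ} {i v : Fin (n + 1)} (hiv : (i : ℕ) + n ≤ v + 1)
    (f : Equiv.Perm (Fin (n + 1)) → ℤ) :
    (∑ σ ∈ avoiders pattern123 (n + 1), if σ i = v then f σ else 0) =
      ∑ τ ∈ avoiders pattern123 n, f (insertPoint i v τ) := by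
  classical
  rw [← Finset.sum_filter]
  have : (avoiders pattern123 (n + 1)).filter (fun σ => σ i = v) =
      (avoiders pattern123 n).image (insertPoint i v) := by
    ext σ
    simp only [Finset.mem_filter, Finset.mem_image, mem_avoiders_pattern123]
    constructor
    · rintro ⟨h, hσ⟩
      obtain ⟨τ, rfl⟩ := exists_eq_insertPoint hσ
      exact ⟨τ, h.of_insertPoint, rfl⟩
    · rintro ⟨τ, h, rfl⟩
      exact ⟨h.insertPoint_corner hiv, insertPoint_self i v τ⟩
  rw [this, Finset.sum_image (insertPoint_injective i v).injOn]

theorem bottomRight_insertPoint {n : ℕ} (hn : 3 ≤ n) {i v : Fin (n + 1)}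
    (hiv : (i : ℕ) + n ≤ v + 1) (τ : Equiv.Perm (Fin n)) :
    bottomRight (insertPoint i v τ) = bottomRight τ := by
  classical
  rw [bottomRight, bottomRight, pointCount, pointCount, Finset.card_filter, Finset.card_filter,
    Fin.sum_univ_succAbove _ i]
  have h0 : ¬ (IsHigh i ∧ IsLow (insertPoint i v τ i)) := by
    rw [insertPoint_self]
    unfold IsHigh IsLow
    omega
  rw [if_neg h0, zero_add]
  refine Finset.sum_congr rfl fun k _ => if_congr ?_ rfl rfl
  rw [insertPoint_succAbove]
  unfold IsHigh IsLow
  simp only [Fin.succAbove, Fin.lt_def]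
  split_ifs <;> simp at * <;> omega

theorem pointCount_isLow_left {n : ℕ} (R : Fin (n + 2) → Prop) [DecidablePred R]
    (σ : Equiv.Perm (Fin (n + 2))) :
    pointCount IsLow R σ = (if R (σ 0) then 1 else 0) + (if R (σ 1) then 1 else 0) := by
  classical
  rw [pointCount, Finset.card_filter, Fin.sum_univ_succ, Fin.sum_univ_succ,
    Finset.sum_eq_zero]
  · simp [IsLow]
  · intro k _
    simp [IsLow]

theorem isHigh_iff {n : ℕ} (v : Fin (n + 2)) :
    IsHigh v ↔ v = Fin.last (n + 1) ∨ v = (Fin.last n).castSucc := by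
  simp only [IsHigh, Fin.ext_iff, Fin.val_last, Fin.val_castSucc]
  omega

theorem topLeft_eq {n : ℕ} (σ : Equiv.Perm (Fin (n + 2))) : topLeft σ =
    (if σ 0 = Fin.last (n + 1) ∨ σ 0 = (Fin.last n).castSucc then 1 else 0) +
    (if σ 1 = Fin.last (n + 1) ∨ σ 1 = (Fin.last n).castSucc then 1 else 0) := by
  classical
  rw [topLeft, pointCount_isLow_left]
  simp only [isHigh_iff]

/-- If the second entry is the second largest value, then the first entry is the largest. -/
theorem Avoids123.eq_last_of_apply_one {n : ℕ} {σ : Equiv.Perm (Fin (n + 2))} (h : Avoids123 σ)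
    (h1 : σ 1 = (Fin.last n).castSucc) : σ 0 = Fin.last (n + 1) := by
  by_contra h0
  have hne : σ 0 ≠ σ 1 := fun e => absurd (σ.injective e) (by simp)
  let k := σ.symm (Fin.last (n + 1))
  have hk : σ k = Fin.last (n + 1) := σ.apply_symm_apply _
  have hk0 : k ≠ 0 := fun e => h0 (e ▸ hk)
  have hk1 : k ≠ 1 := fun e => (Fin.castSucc_lt_last (Fin.last n)).ne (h1.symm.trans (e ▸ hk))
  refine h 0 1 k (by simp) ?_ ?_ ?_
  · rw [Fin.lt_def]
    have e1 := Fin.val_ne_of_ne hk0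
    have e2 := Fin.val_ne_of_ne hk1
    rw [Fin.val_zero] at e1
    rw [Fin.val_one] at e2 ⊢
    omega
  · rw [h1] at hne ⊢
    rw [Fin.lt_def]
    have e1 := Fin.val_ne_of_ne hne
    have e2 := Fin.val_ne_of_ne h0
    simp only [Fin.val_castSucc, Fin.val_last] at e1 e2 ⊢
    omega
  · rw [h1, hk]
    exact Fin.castSucc_lt_last _

/-- A function of the number of points in the top left corner, by inclusion and exclusion over
the cells `(0, n + 1)`, `(1, n + 1)`, `(0, n)`. The cell `(1, n)` is occupied only together with
`(0, n + 1)`. -/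
theorem Avoids123.apply_topLeft {n : ℕ} {σ : Equiv.Perm (Fin (n + 2))} (h : Avoids123 σ)
    (G : ℕ → ℤ) : G (topLeft σ) = G 0 +
      (if σ 0 = Fin.last (n + 1) then G 1 - G 0 else 0) +
      (if σ 1 = Fin.last (n + 1) then G 1 - G 0 else 0) +
      (if σ 0 = (Fin.last n).castSucc then G 1 - G 0 else 0) +
      (if σ 0 = Fin.last (n + 1) then
        if σ 1 = (Fin.last n).castSucc then G 2 - G 1 else 0 else 0) +
      (if σ 1 = Fin.last (n + 1) then
        if σ 0 = (Fin.last n).castSucc then G 2 - 2 * G 1 + G 0 else 0 else 0) := by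
  have hl : Fin.last (n + 1) ≠ (Fin.last n).castSucc := (Fin.castSucc_lt_last _).ne'
  have hne : σ 0 ≠ σ 1 := fun e => absurd (σ.injective e) (by simp)
  rw [topLeft_eq]
  by_cases h0 : σ 0 = Fin.last (n + 1)
  · have h1 : σ 1 ≠ Fin.last (n + 1) := fun e => hne (h0.trans e.symm)
    by_cases h2 : σ 1 = (Fin.last n).castSucc <;> simp [h0, h1, h2, hl, hl.symm]
  · have h2 : σ 1 ≠ (Fin.last n).castSucc := fun e => h0 (h.eq_last_of_apply_one e)
    by_cases h1 : σ 1 = Fin.last (n + 1) <;> by_cases h3 : σ 0 = (Fin.last n).castSucc <;>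
      simp [h0, h1, h2, h3, hl, hl.symm]
    ring

/-- Summation over the number of points in the top left corner. Deleting such points leaves the
bottom right corner unchanged and leads to shorter avoiders. -/
theorem sum_avoiders_topLeft_bottomRight {n : ℕ} (hn : 3 ≤ n) (G : ℕ → ℕ → ℤ) :
    ∑ σ ∈ avoiders pattern123 (n + 2), G (topLeft σ) (bottomRight σ) =
      ∑ σ ∈ avoiders pattern123 (n + 2), G 0 (bottomRight σ) +
      3 * ∑ σ ∈ avoiders pattern123 (n + 1), (G 1 (bottomRight σ) - G 0 (bottomRight σ)) +
      ∑ σ ∈ avoiders pattern123 n,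
        (G 0 (bottomRight σ) - 3 * G 1 (bottomRight σ) + 2 * G 2 (bottomRight σ)) := by
  rw [Finset.sum_congr rfl fun σ hσ =>
    (mem_avoiders_pattern123.1 hσ).apply_topLeft (fun t => G t (bottomRight σ))]
  simp only [Finset.sum_add_distrib]
  have c1 : ((0 : Fin (n + 2)) : ℕ) + (n + 1) ≤ (Fin.last (n + 1) : ℕ) + 1 := by simp
  have c2 : ((1 : Fin (n + 2)) : ℕ) + (n + 1) ≤ (Fin.last (n + 1) : ℕ) + 1 := by simp; omega
  have c3 : ((0 : Fin (n + 2)) : ℕ) + (n + 1) ≤ ((Fin.last n).castSucc : ℕ) + 1 := by simp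
  have d1 : ((0 : Fin (n + 1)) : ℕ) + n ≤ (Fin.last n : ℕ) + 1 := by simp
  rw [sum_avoiders_ite_eq c1, sum_avoiders_ite_eq c2, sum_avoiders_ite_eq c3,
    sum_avoiders_ite_eq c1, sum_avoiders_ite_eq c2]
  have e1 : ∀ τ : Equiv.Perm (Fin (n + 1)),
      insertPoint 0 (Fin.last (n + 1)) τ 1 = (Fin.last n).castSucc ↔ τ 0 = Fin.last n := by
    intro τ
    rw [← Fin.succ_zero_eq_one, insertPoint_zero_succ, Fin.succAbove_last]
    exact Fin.castSucc_inj
  have e2 : ∀ τ : Equiv.Perm (Fin (n + 1)),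
      insertPoint 1 (Fin.last (n + 1)) τ 0 = (Fin.last n).castSucc ↔ τ 0 = Fin.last n := by
    intro τ
    have : (0 : Fin (n + 2)) = (1 : Fin (n + 2)).succAbove 0 := Fin.one_succAbove_zero.symm
    rw [this, insertPoint_succAbove, Fin.succAbove_last]
    exact Fin.castSucc_inj
  simp only [e1, e2, bottomRight_insertPoint (by omega : 3 ≤ n + 1) c1,
    bottomRight_insertPoint (by omega : 3 ≤ n + 1) c2,
    bottomRight_insertPoint (by omega : 3 ≤ n + 1) c3]
  rw [sum_avoiders_ite_eq d1, sum_avoiders_ite_eq d1]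
  simp only [bottomRight_insertPoint hn d1, Finset.sum_add_distrib, Finset.sum_sub_distrib,
    ← Finset.mul_sum]
  ring

theorem sum_avoiders_bottomRight {n : ℕ} (hn : 3 ≤ n) (W : ℕ → ℤ) :
    ∑ σ ∈ avoiders pattern123 (n + 2), W (bottomRight σ) =
      W 0 * catalan (n + 2) + 3 * ((W 1 - W 0) * catalan (n + 1)) +
        (W 0 - 3 * W 1 + 2 * W 2) * catalan n := by
  rw [← sum_avoiders_reverseComplement]
  simp only [bottomRight_reverseComplement]
  rw [sum_avoiders_topLeft_bottomRight hn (fun t _ => W t)]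
  simp only [Finset.sum_const, card_avoiders_pattern123, nsmul_eq_mul]
  ring

/-- The joint distribution of the two corners: the operator of
`sum_avoiders_topLeft_bottomRight`, applied twice to the Catalan numbers. -/
theorem sum_avoiders_add_corners {n : ℕ} (hn : 3 ≤ n) (h : ℕ → ℤ) :
    ∑ σ ∈ avoiders pattern123 (n + 4), h (topLeft σ + bottomRight σ) =
      h 0 * (catalan (n + 4) - 6 * catalan (n + 3) + 11 * catalan (n + 2) - 6 * catalan (n + 1)
          + catalan n) +
      h 1 * (6 * catalan (n + 3) - 24 * catalan (n + 2) + 24 * catalan (n + 1) - 6 * catalan n) +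
      h 2 * (13 * catalan (n + 2) - 30 * catalan (n + 1) + 13 * catalan n) +
      h 3 * (12 * catalan (n + 1) - 12 * catalan n) + h 4 * (4 * catalan n) := by
  rw [sum_avoiders_topLeft_bottomRight (by omega : 3 ≤ n + 2) (fun t b => h (t + b))]
  rw [sum_avoiders_bottomRight (by omega : 3 ≤ n + 2) (fun b => h (0 + b)),
    sum_avoiders_bottomRight (by omega : 3 ≤ n + 1) (fun b => h (1 + b) - h (0 + b)),
    sum_avoiders_bottomRight hn (fun b => h (0 + b) - 3 * h (1 + b) + 2 * h (2 + b))]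
  norm_num
  ring

/-! ### Avoiders with a point in the bottom left corner -/

/-- The permutation `0, n, n - 1, …, 1`. -/
def minThenDecreasing (n : ℕ) : Equiv.Perm (Fin (n + 1)) := insertPoint 0 0 Fin.revPerm

@[simp]
theorem minThenDecreasing_zero (n : ℕ) : minThenDecreasing n 0 = 0 := insertPoint_self _ _ _

theorem minThenDecreasing_succ {n : ℕ} (k : Fin n) :
    minThenDecreasing n k.succ = k.rev.succ := by
  simp [minThenDecreasing]

@[simp]
theorem minThenDecreasing_one (n : ℕ) : minThenDecreasing (n + 1) 1 = Fin.last (n + 1) := by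
  rw [← Fin.succ_zero_eq_one, minThenDecreasing_succ, Fin.rev_zero, Fin.succ_last]

@[simp]
theorem minThenDecreasing_last (n : ℕ) : minThenDecreasing (n + 1) (Fin.last (n + 1)) = 1 := by
  rw [← Fin.succ_last, minThenDecreasing_succ, Fin.rev_last, Fin.succ_zero_eq_one]

theorem minThenDecreasing_lt {n : ℕ} {a b : Fin (n + 1)} (ha : 0 < a) (hab : a < b) :
    minThenDecreasing n b < minThenDecreasing n a := by
  obtain ⟨a, rfl⟩ := Fin.exists_succ_eq.2 ha.ne'
  obtain ⟨b, rfl⟩ := Fin.exists_succ_eq.2 (ha.trans hab).ne'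
  simpa [minThenDecreasing_succ] using hab

theorem decreasingFrom_zero_iff {n : ℕ} {τ : Equiv.Perm (Fin n)} :
    DecreasingFrom 0 τ ↔ τ = Fin.revPerm := by
  constructor
  · intro h
    have hm : StrictMono fun k => (τ k).rev := fun i j hij =>
      Fin.rev_lt_rev.2 (h i j hij (Nat.zero_le _) (Nat.zero_le _))
    have := (StrictMono.range_inj hm strictMono_id).1 (by
      rw [Set.range_id]
      exact (Fin.rev_surjective.comp τ.surjective).range_eq)
    ext k
    have := congrFun this k
    simp only [id] at this
    rw [Fin.revPerm_apply, ← this, Fin.rev_rev, this]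
  · rintro rfl i j hij _ _
    simpa using hij

theorem avoids123_minThenDecreasing (n : ℕ) : Avoids123 (minThenDecreasing n) :=
  fun _ _ _ hab hbc _ h => (minThenDecreasing_lt (lt_of_le_of_lt (Fin.zero_le _) hab) hbc).not_gt h

theorem avoids123_and_apply_zero_eq_zero_iff {n : ℕ} {σ : Equiv.Perm (Fin (n + 1))} :
    Avoids123 σ ∧ σ 0 = 0 ↔ minThenDecreasing n = σ := by
  constructor
  · rintro ⟨h, h0⟩
    obtain ⟨τ, rfl⟩ := exists_eq_insertPoint h0
    rw [avoids123_insertPoint_zero_iff, Fin.val_zero, decreasingFrom_zero_iff] at h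
    rw [minThenDecreasing, h.2]
  · rintro rfl
    exact ⟨avoids123_minThenDecreasing n, minThenDecreasing_zero n⟩

theorem Avoids123.decreasingFrom {n c : ℕ} {τ : Equiv.Perm (Fin (n + 1))} (h : Avoids123 τ)
    (hc : (τ 0 : ℕ) < c) : DecreasingFrom c τ := by
  intro i j hij hi hj
  have hi0 : 0 < i := Fin.pos_iff_ne_zero.2 (by rintro rfl; omega)
  have := h 0 i j hi0 hij (Fin.lt_def.2 (hc.trans_le hi))
  exact lt_of_le_of_ne (not_lt.1 this) fun e => hij.ne' (τ.injective e)

theorem avoids123_and_apply_zero_eq_one_iff {n : ℕ} {σ : Equiv.Perm (Fin (n + 2))} :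
    Avoids123 σ ∧ σ 0 = 1 ↔
      ∃ p : Fin (n + 1), insertPoint p.succ 0 (minThenDecreasing n) = σ := by
  constructor
  · rintro ⟨h, h0⟩
    have hq0 : σ.symm 0 ≠ 0 := fun e => by
      rw [Equiv.symm_apply_eq, h0] at e
      simp at e
    obtain ⟨p, hp⟩ := Fin.exists_succ_eq.2 hq0
    obtain ⟨τ, rfl⟩ := exists_eq_insertPoint (show σ p.succ = 0 by rw [hp]; simp)
    refine ⟨p, ?_⟩
    have hτ : τ 0 = 0 := by
      have e := insertPoint_succAbove p.succ 0 τ 0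
      rw [Fin.succ_succAbove_zero, h0, Fin.succAbove_zero_apply, ← Fin.succ_zero_eq_one] at e
      exact (Fin.succ_injective _ e).symm
    rw [avoids123_and_apply_zero_eq_zero_iff.1 ⟨h.of_insertPoint, hτ⟩]
  · rintro ⟨p, rfl⟩
    constructor
    · refine (avoids123_minThenDecreasing n).insertPoint fun a b c hab hbc h1 h2 => ?_
      have hb : b ≠ p.succ := by rintro rfl; simp at h1
      have hc : c ≠ p.succ := by rintro rfl; simp at h2
      -- After the first position all entries other than the new `0` decrease, so that `b` and
      -- `c` cannot both lie there.
      exfalso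
      obtain ⟨b, rfl⟩ := Fin.exists_succAbove_eq hb
      obtain ⟨c, rfl⟩ := Fin.exists_succAbove_eq hc
      simp only [insertPoint_succAbove, Fin.succAbove_lt_succAbove_iff] at hbc h2
      refine (minThenDecreasing_lt (Fin.pos_iff_ne_zero.2 ?_) hbc).not_gt h2
      rintro rfl
      rw [Fin.succ_succAbove_zero] at hab
      exact absurd hab (Fin.not_lt_zero a)
    · have e := insertPoint_succAbove p.succ 0 (minThenDecreasing n) 0
      rwa [Fin.succ_succAbove_zero, minThenDecreasing_zero, Fin.succAbove_zero_apply,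
        Fin.succ_zero_eq_one] at e

theorem avoids123_and_apply_one_eq_zero_iff {n : ℕ} {σ : Equiv.Perm (Fin (n + 2))} :
    Avoids123 σ ∧ σ 1 = 0 ↔
      ∃ v : Fin (n + 1), insertPoint 0 v.succ (minThenDecreasing n) = σ := by
  constructor
  · rintro ⟨h, h1⟩
    have h0 : σ 0 ≠ 0 := fun e => absurd (σ.injective (e.trans h1.symm)) (by simp)
    obtain ⟨v, hv⟩ := Fin.exists_succ_eq.2 h0
    obtain ⟨τ, rfl⟩ := exists_eq_insertPoint hv.symm
    refine ⟨v, ?_⟩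
    rw [← Fin.succ_zero_eq_one, insertPoint_zero_succ, Fin.succAbove_eq_zero_iff
      (Fin.succ_ne_zero v)] at h1
    rw [avoids123_and_apply_zero_eq_zero_iff.1 ⟨h.of_insertPoint, h1⟩]
  · rintro ⟨v, rfl⟩
    refine ⟨avoids123_insertPoint_zero_iff.2 ⟨avoids123_minThenDecreasing n,
      (avoids123_minThenDecreasing n).decreasingFrom (by simp)⟩, ?_⟩
    rw [← Fin.succ_zero_eq_one, insertPoint_zero_succ, minThenDecreasing_zero,
      Fin.succ_succAbove_zero]

theorem avoids123_and_apply_one_eq_one_iff {n : ℕ} {σ : Equiv.Perm (Fin (n + 3))} :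
    Avoids123 σ ∧ σ 1 = 1 ↔ ∃ x : Fin (n + 1) × Fin (n + 1),
      insertPoint 0 x.1.succ.succ (insertPoint x.2.succ 0 (minThenDecreasing n)) = σ := by
  constructor
  · rintro ⟨h, h1⟩
    have h0 : σ 0 ≠ 0 := fun e => by
      rw [← avoids123_and_apply_zero_eq_zero_iff.1 ⟨h, e⟩, minThenDecreasing_one] at h1
      simp [Fin.ext_iff] at h1
    have h0' : σ 0 ≠ 1 := fun e => absurd (σ.injective (e.trans h1.symm)) (by simp)
    obtain ⟨w, hw⟩ := Fin.exists_succ_eq.2 h0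
    obtain ⟨v, rfl⟩ := Fin.exists_succ_eq.2 (show w ≠ 0 by rintro rfl; exact h0' hw.symm)
    obtain ⟨τ, rfl⟩ := exists_eq_insertPoint hw.symm
    have e : (1 : Fin (n + 3)) = v.succ.succ.succAbove 1 := by
      simp [Fin.succAbove, Fin.lt_def]
    have hτ : τ 0 = 1 := by
      rw [← Fin.succ_zero_eq_one, insertPoint_zero_succ, Fin.succ_zero_eq_one, e] at h1
      exact Fin.succAbove_right_injective h1
    obtain ⟨p, rfl⟩ := avoids123_and_apply_zero_eq_one_iff.1 ⟨h.of_insertPoint, hτ⟩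
    exact ⟨(v, p), rfl⟩
  · rintro ⟨⟨v, p⟩, rfl⟩
    obtain ⟨h, h0⟩ := avoids123_and_apply_zero_eq_one_iff.2 ⟨p, rfl⟩
    refine ⟨avoids123_insertPoint_zero_iff.2 ⟨h, h.decreasingFrom (by simp [h0])⟩, ?_⟩
    rw [← Fin.succ_zero_eq_one, insertPoint_zero_succ, h0]
    simp [Fin.succAbove, Fin.lt_def]

theorem sum_avoiders_ite_of_iff {ι : Type*} [Fintype ι] {n : ℕ} {P : Equiv.Perm (Fin n) → Prop}
    [DecidablePred P] {F : ι → Equiv.Perm (Fin n)} (hF : Function.Injective F)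
    (hP : ∀ σ, Avoids123 σ ∧ P σ ↔ ∃ x, F x = σ) (f : Equiv.Perm (Fin n) → ℤ) :
    (∑ σ ∈ avoiders pattern123 n, if P σ then f σ else 0) = ∑ x, f (F x) := by
  classical
  rw [← Finset.sum_filter]
  have : (avoiders pattern123 n).filter P = Finset.univ.image F := by
    ext σ
    simp [mem_avoiders_pattern123, hP]
  rw [this, Finset.sum_image hF.injOn]

theorem bottomLeft_eq {n : ℕ} (σ : Equiv.Perm (Fin (n + 2))) : bottomLeft σ =
    (if (σ 0 : ℕ) < 2 then 1 else 0) + (if (σ 1 : ℕ) < 2 then 1 else 0) :=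
  pointCount_isLow_left (fun v : Fin (n + 2) => (v : ℕ) < 2) σ

theorem topLeft_eq_ite {n : ℕ} (σ : Equiv.Perm (Fin (n + 2))) : topLeft σ =
    (if n ≤ (σ 0 : ℕ) then 1 else 0) + (if n ≤ (σ 1 : ℕ) then 1 else 0) := by
  have e : (IsHigh : Fin (n + 2) → Prop) = fun v : Fin (n + 2) => n ≤ (v : ℕ) := by
    ext v
    exact Nat.add_le_add_iff_right
  rw [topLeft, e, pointCount_isLow_left]

theorem bottomRight_eq {n : ℕ} {σ : Equiv.Perm (Fin (n + 2))} {x y : Fin (n + 2)}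
    (hx : σ x = 0) (hy : σ y = 1) : bottomRight σ =
    (if n ≤ (x : ℕ) then 1 else 0) + (if n ≤ (y : ℕ) then 1 else 0) := by
  have := topLeft_eq_ite σ.symm
  rw [topLeft, pointCount_symm] at this
  rw [bottomRight, this, σ.symm_apply_eq.2 hx.symm, σ.symm_apply_eq.2 hy.symm]

/-- The effect on `h` of the points in the bottom left corner. -/
noncomputable def bottomLeftEffect {n : ℕ} (h : ℕ → ℤ) (σ : Equiv.Perm (Fin n)) : ℤ :=
  h (topLeft σ + bottomRight σ + bottomLeft σ) - h (topLeft σ + bottomRight σ)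

theorem Avoids123.bottomLeftEffect_eq {n : ℕ} {σ : Equiv.Perm (Fin (n + 3))} (hσ : Avoids123 σ)
    (h : ℕ → ℤ) : bottomLeftEffect h σ =
      (if σ 0 = 0 then bottomLeftEffect h σ else 0) +
      (if σ 1 = 0 then bottomLeftEffect h σ else 0) +
      (if σ 0 = 1 then if σ 1 = 0 then 0 else bottomLeftEffect h σ else 0) +
      (if σ 1 = 1 then bottomLeftEffect h σ else 0) := by
  have hne : σ 0 ≠ σ 1 := fun e => absurd (σ.injective e) (by simp)
  have h01 : (0 : Fin (n + 3)) ≠ 1 := by simp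
  by_cases h0 : σ 0 = 0
  · have h1 : σ 1 ≠ 0 := fun e => hne (h0.trans e.symm)
    have h2 : σ 1 ≠ 1 := by
      rw [← avoids123_and_apply_zero_eq_zero_iff.1 ⟨hσ, h0⟩, minThenDecreasing_one]
      simp [Fin.ext_iff]
    simp [h0, h1, h2]
  · by_cases h1 : σ 1 = 0
    · by_cases h2 : σ 0 = 1 <;> simp [h0, h1, h2, h01]
    · by_cases h2 : σ 0 = 1
      · have h3 : σ 1 ≠ 1 := fun e => hne (h2.trans e.symm)
        simp [h1, h2, h3]
      · by_cases h3 : σ 1 = 1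
        · simp [h0, h2, h3]
        · have : bottomLeft σ = 0 := by
            have e0 := Fin.val_ne_of_ne h0
            have e1 := Fin.val_ne_of_ne h1
            have e2 := Fin.val_ne_of_ne h2
            have e3 := Fin.val_ne_of_ne h3
            rw [Fin.val_zero] at e0 e1
            rw [Fin.val_one] at e2 e3
            rw [bottomLeft_eq, if_neg (by omega), if_neg (by omega)]
          simp [h0, h1, h2, h3, bottomLeftEffect, this]

theorem sum_fin_ite_le (m : ℕ) (F : ℕ → ℤ) :
    (∑ v : Fin (m + 2), F (if m ≤ (v : ℕ) then 1 else 0)) = m * F 0 + 2 * F 1 := by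
  rw [Fin.sum_univ_castSucc, Fin.sum_univ_castSucc, Finset.sum_congr rfl
    (g := fun _ => F 0) fun v _ => by
      simp only [Fin.val_castSucc]; rw [if_neg (by have := v.2; omega)]]
  simp
  ring

/-- The sum over all avoiders with a point in the bottom left corner, according to which of the
four cells of that corner is occupied. -/
theorem sum_bottomLeftEffect (m : ℕ) (h : ℕ → ℤ) :
    ∑ σ ∈ avoiders pattern123 (m + 4), bottomLeftEffect h σ =
      m ^ 2 * (h 1 - h 0) + (h 2 - h 0) + 6 * m * (h 2 - h 1) + 9 * (h 3 - h 2) := by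
  rw [Finset.sum_congr rfl fun σ hσ =>
    (mem_avoiders_pattern123.1 hσ).bottomLeftEffect_eq h]
  simp only [Finset.sum_add_distrib]
  -- `0, n, …, 1` has one point in each corner but the top right one.
  have s1 : (∑ σ ∈ avoiders pattern123 (m + 4), if σ 0 = 0 then bottomLeftEffect h σ else 0) =
      h 3 - h 2 := by
    rw [sum_avoiders_ite_of_iff (F := fun _ : Unit => minThenDecreasing (m + 3))
      (Function.injective_of_subsingleton _) fun σ => by
        simp [avoids123_and_apply_zero_eq_zero_iff]]
    simp [bottomLeftEffect, topLeft_eq_ite, bottomLeft_eq,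
      bottomRight_eq (minThenDecreasing_zero _) (minThenDecreasing_last _)]
  -- `v, 0, …`: the entry `1` comes last, unless `v = 1` and the bottom left corner has two points.
  have s2 : (∑ σ ∈ avoiders pattern123 (m + 4), if σ 1 = 0 then bottomLeftEffect h σ else 0) =
      (h 2 - h 0) + (m * (h 2 - h 1) + 2 * (h 3 - h 2)) := by
    rw [sum_avoiders_ite_of_iff (fun v w e => ?_)
      fun σ => avoids123_and_apply_one_eq_zero_iff]
    swap
    · have := congrArg (fun σ : Equiv.Perm (Fin (m + 4)) => σ 0) e
      simpa using this
    have a1 : ∀ v : Fin (m + 3), insertPoint 0 v.succ (minThenDecreasing (m + 2)) 1 = 0 :=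
      fun v => (avoids123_and_apply_one_eq_zero_iff.2 ⟨v, rfl⟩).2
    rw [Fin.sum_univ_succ, ← sum_fin_ite_le m fun k => h (k + 2) - h (k + 1)]
    congr 1
    · have a0 : insertPoint 0 (0 : Fin (m + 3)).succ (minThenDecreasing (m + 2)) 0 = 1 :=
        insertPoint_self _ _ _
      have b1 := a1 0
      generalize insertPoint 0 (0 : Fin (m + 3)).succ (minThenDecreasing (m + 2)) = σ at a0 b1 ⊢
      simp [bottomLeftEffect, topLeft_eq_ite, bottomLeft_eq, a0, b1, bottomRight_eq b1 a0]
    · refine Finset.sum_congr rfl fun w _ => ?_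
      have a2 : insertPoint 0 w.succ.succ (minThenDecreasing (m + 2)) (Fin.last (m + 3)) = 1 := by
        rw [← Fin.succ_last, insertPoint_zero_succ, minThenDecreasing_last]
        simp [Fin.succAbove, Fin.lt_def]
      simp [bottomLeftEffect, topLeft_eq_ite, bottomLeft_eq, a1, bottomRight_eq (a1 _) a2]
  -- `1, n, …` with `0` in the position `p`; the case `p = 1` belongs to the previous sum.
  have s3 : (∑ σ ∈ avoiders pattern123 (m + 4),
      if σ 0 = 1 then if σ 1 = 0 then 0 else bottomLeftEffect h σ else 0) =
      m * (h 2 - h 1) + 2 * (h 3 - h 2) := by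
    rw [sum_avoiders_ite_of_iff (fun v w e => ?_)
      fun σ => avoids123_and_apply_zero_eq_one_iff]
    swap
    · have := congrArg (fun σ : Equiv.Perm (Fin (m + 4)) => σ.symm 0) e
      simp only [(Equiv.symm_apply_eq _).2 (insertPoint_self _ _ _).symm] at this
      exact Fin.succ_injective _ this
    have a0 : ∀ p : Fin (m + 3), insertPoint p.succ 0 (minThenDecreasing (m + 2)) 0 = 1 :=
      fun p => (avoids123_and_apply_zero_eq_one_iff.2 ⟨p, rfl⟩).2
    rw [Fin.sum_univ_succ, ← sum_fin_ite_le m fun k => h (k + 2) - h (k + 1)]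
    have b0 : insertPoint (0 : Fin (m + 3)).succ 0 (minThenDecreasing (m + 2)) 1 = 0 :=
      insertPoint_self _ _ _
    rw [if_pos b0, zero_add]
    refine Finset.sum_congr rfl fun w _ => ?_
    have a1 : insertPoint w.succ.succ 0 (minThenDecreasing (m + 2)) 1 = Fin.last (m + 3) := by
      have e : (1 : Fin (m + 4)) = w.succ.succ.succAbove 1 := by
        simp [Fin.succAbove, Fin.lt_def]
      rw [e, insertPoint_succAbove, minThenDecreasing_one]
      simp
    have a2 : insertPoint w.succ.succ 0 (minThenDecreasing (m + 2)) w.succ.succ = 0 :=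
      insertPoint_self _ _ _
    simp [bottomLeftEffect, topLeft_eq_ite, bottomLeft_eq, a0, a1, bottomRight_eq a2 (a0 _),
      Fin.ext_iff]
    ring_nf
  -- `v, 1, …` with `0` in some later position `p`: the other two corners depend on `v` and on `p`
  -- independently of each other.
  have s4 : (∑ σ ∈ avoiders pattern123 (m + 4), if σ 1 = 1 then bottomLeftEffect h σ else 0) =
      m * (m * (h 1 - h 0) + 2 * (h 2 - h 1)) + 2 * (m * (h 2 - h 1) + 2 * (h 3 - h 2)) := by
    rw [sum_avoiders_ite_of_iff (fun x y e => ?_)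
      fun σ => avoids123_and_apply_one_eq_one_iff]
    swap
    · have e1 := congrArg (fun σ : Equiv.Perm (Fin (m + 4)) => σ 0) e
      simp only [insertPoint_self, Fin.succ_inj] at e1
      rw [e1] at e
      have e2 := congrArg (fun σ : Equiv.Perm (Fin (m + 3)) => σ.symm 0)
        (insertPoint_injective _ _ e)
      simp only [(Equiv.symm_apply_eq _).2 (insertPoint_self _ _ _).symm] at e2
      exact Prod.ext e1 (Fin.succ_injective _ e2)
    have e0 := sum_fin_ite_le m fun k => h (0 + k + 1) - h (0 + k)
    have e1 := sum_fin_ite_le m fun k => h (1 + k + 1) - h (1 + k)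
    have e2 := sum_fin_ite_le m fun l => ∑ p : Fin (m + 2),
      (h (l + (if m ≤ (p : ℕ) then 1 else 0) + 1) - h (l + (if m ≤ (p : ℕ) then 1 else 0)))
    rw [e0, e1] at e2
    norm_num only at e2
    rw [Fintype.sum_prod_type, ← e2]
    refine Finset.sum_congr rfl fun v _ => Finset.sum_congr rfl fun p _ => ?_
    have a1 := (avoids123_and_apply_one_eq_one_iff.2 ⟨(v, p), rfl⟩).2
    have a2 : insertPoint 0 v.succ.succ (insertPoint p.succ 0 (minThenDecreasing (m + 1)))
        p.succ.succ = 0 := by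
      rw [insertPoint_zero_succ, insertPoint_self, Fin.succ_succAbove_zero]
    simp [bottomLeftEffect, topLeft_eq_ite, bottomLeft_eq, a1, bottomRight_eq a2 a1]
  rw [s1, s2, s3, s4]
  ring

/-! ### The coefficients -/

theorem exists_of_pointCount_ne_zero {n : ℕ} {P R : Fin n → Prop} {σ : Equiv.Perm (Fin n)}
    (h : pointCount P R σ ≠ 0) : ∃ i, P i ∧ R (σ i) := by
  classical
  obtain ⟨i, hi⟩ := Finset.card_ne_zero.1 h
  exact ⟨i, by simpa using hi⟩

/-- If both corners were occupied, the entries in the positions `2`, `3`, `4` would have to lie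
below the one point or above the other, which leaves only two values for them. -/
theorem Avoids123.bottomLeft_eq_zero_or_topRight_eq_zero {n : ℕ} (hn : 7 ≤ n)
    {σ : Equiv.Perm (Fin n)} (h : Avoids123 σ) : bottomLeft σ = 0 ∨ topRight σ = 0 := by
  by_contra hc
  push Not at hc
  obtain ⟨i, hi, hi'⟩ := exists_of_pointCount_ne_zero hc.1
  obtain ⟨j, hj, hj'⟩ := exists_of_pointCount_ne_zero hc.2
  unfold IsLow at hi hi'
  unfold IsHigh at hj hj'
  have key : ∀ k : Fin n, 2 ≤ (k : ℕ) → (k : ℕ) ≤ 4 →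
      (σ k : ℕ) = 0 ∨ (σ k : ℕ) = n - 1 := by
    intro k hk hk'
    have h1 := h i k j (by rw [Fin.lt_def]; omega) (by rw [Fin.lt_def]; omega)
    have hki : (σ k : ℕ) ≠ σ i := fun e => by
      have := σ.injective (Fin.ext e)
      subst this
      omega
    have hkj : (σ k : ℕ) ≠ σ j := fun e => by
      have := σ.injective (Fin.ext e)
      subst this
      omega
    simp only [Fin.lt_def] at h1
    omega
  have hne : ∀ a b : Fin n, (a : ℕ) ≠ b → (σ a : ℕ) ≠ σ b :=
    fun a b hab e => hab (congrArg Fin.val (σ.injective (Fin.ext e)))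
  have k2 := key ⟨2, by omega⟩ (by simp) (by simp)
  have k3 := key ⟨3, by omega⟩ (by simp) (by simp)
  have k4 := key ⟨4, by omega⟩ (by simp) (by simp)
  have n1 := hne ⟨2, by omega⟩ ⟨3, by omega⟩ (by simp)
  have n2 := hne ⟨2, by omega⟩ ⟨4, by omega⟩ (by simp)
  have n3 := hne ⟨3, by omega⟩ ⟨4, by omega⟩ (by simp)
  omega

theorem sum_avoiders_add_four_corners {n : ℕ} (hn : 7 ≤ n) (h : ℕ → ℤ) :
    ∑ σ ∈ avoiders pattern123 n, h (topLeft σ + bottomRight σ + bottomLeft σ + topRight σ) =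
      ∑ σ ∈ avoiders pattern123 n, h (topLeft σ + bottomRight σ) +
        2 * ∑ σ ∈ avoiders pattern123 n, bottomLeftEffect h σ := by
  rw [two_mul]
  nth_rw 3 [← sum_avoiders_reverseComplement]
  rw [← Finset.sum_add_distrib, ← Finset.sum_add_distrib]
  refine Finset.sum_congr rfl fun σ hσ => ?_
  simp only [bottomLeftEffect, topLeft_reverseComplement, bottomRight_reverseComplement,
    bottomLeft_reverseComplement, add_comm (bottomRight σ) (topLeft σ)]
  rcases (mem_avoiders_pattern123.1 hσ).bottomLeft_eq_zero_or_topRight_eq_zero hn with e | e <;>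
    simp [e]

theorem coeffAt_Qpoly_eq_sum {n : ℕ} (hn : 4 ≤ n) (j : ℕ) :
    coeffAt (Qpoly pattern123 0 2 0 2 n) ((n : ℤ) - 8 + j) =
      ∑ σ ∈ avoiders pattern123 n,
        if topLeft σ + bottomRight σ + bottomLeft σ + topRight σ = j then 1 else 0 := by
  rw [coeffAt, Qpoly]
  split_ifs with h0
  · rw [finsetSum_coeff]
    refine Finset.sum_congr rfl fun σ hσ => ?_
    have := (mem_avoiders_pattern123.1 hσ).mmp_add_eight hn
    rw [coeff_X_pow]
    exact if_congr (by omega) rfl rfl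
  · refine (Finset.sum_eq_zero fun σ hσ => if_neg ?_).symm
    have := (mem_avoiders_pattern123.1 hσ).mmp_add_eight hn
    omega

theorem coeffAt_Qpoly_eq {m : ℕ} (hm : 3 ≤ m) (j : ℕ) (h : ℕ → ℤ)
    (hh : ∀ k, h k = if k = j then 1 else 0) :
    coeffAt (Qpoly pattern123 0 2 0 2 (m + 4)) (((m + 4 : ℕ) : ℤ) - 8 + j) =
      h 0 * (catalan (m + 4) - 6 * catalan (m + 3) + 11 * catalan (m + 2) - 6 * catalan (m + 1)
          + catalan m) +
      h 1 * (6 * catalan (m + 3) - 24 * catalan (m + 2) + 24 * catalan (m + 1) - 6 * catalan m) +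
      h 2 * (13 * catalan (m + 2) - 30 * catalan (m + 1) + 13 * catalan m) +
      h 3 * (12 * catalan (m + 1) - 12 * catalan m) + h 4 * (4 * catalan m) +
      2 * (m ^ 2 * (h 1 - h 0) + (h 2 - h 0) + 6 * m * (h 2 - h 1) + 9 * (h 3 - h 2)) := by
  rw [coeffAt_Qpoly_eq_sum (by omega), ← sum_avoiders_add_corners hm, ← sum_bottomLeftEffect,
    ← sum_avoiders_add_four_corners (by omega)]
  simp only [hh]

theorem mainTheorem12 (n : ℕ) (hn : 7 ≤ n) :
    coeffAt (Qpoly pattern123 0 2 0 2 n) ((n : ℤ) - 8) =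
        (catalan n : ℤ) - 6 * catalan (n - 1) + 11 * catalan (n - 2) - 6 * catalan (n - 3)
          + catalan (n - 4) - 2 * (n : ℤ) ^ 2 + 16 * n - 34 ∧
    coeffAt (Qpoly pattern123 0 2 0 2 n) ((n : ℤ) - 7) =
        6 * (catalan (n - 1) : ℤ) - 24 * catalan (n - 2) + 24 * catalan (n - 3)
          - 6 * catalan (n - 4) + 2 * (n : ℤ) ^ 2 - 28 * n + 80 ∧
    coeffAt (Qpoly pattern123 0 2 0 2 n) ((n : ℤ) - 6) =
        13 * (catalan (n - 2) : ℤ) - 30 * catalan (n - 3) + 13 * catalan (n - 4)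
          + 12 * n - 64 ∧
    coeffAt (Qpoly pattern123 0 2 0 2 n) ((n : ℤ) - 5) =
        12 * (catalan (n - 3) : ℤ) - 12 * catalan (n - 4) + 18 ∧
    coeffAt (Qpoly pattern123 0 2 0 2 n) ((n : ℤ) - 4) = 4 * (catalan (n - 4) : ℤ) := by
  obtain ⟨m, rfl⟩ : ∃ m, n = m + 4 := ⟨n - 4, by omega⟩
  have key := fun j => coeffAt_Qpoly_eq (m := m) (by omega) j _ (fun _ => rfl)
  have e1 : m + 4 - 1 = m + 3 := rfl
  have e2 : m + 4 - 2 = m + 2 := rfl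
  have e3 : m + 4 - 3 = m + 1 := rfl
  have e4 : m + 4 - 4 = m := rfl
  rw [e1, e2, e3, e4]
  refine ⟨?_, ?_, ?_, ?_, ?_⟩
  · rw [show ((m + 4 : ℕ) : ℤ) - 8 = ((m + 4 : ℕ) : ℤ) - 8 + (0 : ℕ) by simp, key]
    norm_num
    ring
  · rw [show ((m + 4 : ℕ) : ℤ) - 7 = ((m + 4 : ℕ) : ℤ) - 8 + (1 : ℕ) by push_cast; ring, key]
    norm_num
    ring
  · rw [show ((m + 4 : ℕ) : ℤ) - 6 = ((m + 4 : ℕ) : ℤ) - 8 + (2 : ℕ) by push_cast; ring, key]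
    norm_num
    ring
  · rw [show ((m + 4 : ℕ) : ℤ) - 5 = ((m + 4 : ℕ) : ℤ) - 8 + (3 : ℕ) by push_cast; ring, key]
    norm_num
  · rw [show ((m + 4 : ℕ) : ℤ) - 4 = ((m + 4 : ℕ) : ℤ) - 8 + (4 : ℕ) by push_cast; ring, key]
    norm_num
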